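/- Let $\mathbb T=\mathbb R/\mathbb Z$ and let $T(t,s)=(t,s+t)$ on $\mathbb T^2$, equipped with the product Lebesgue measure $\lambda=dt\times ds$. A joining of two measure-preserving systems $(X,T,\mu)$ and $(Y,S,\nu)$ is a $T\times S$-invariant measure $\xi$ on $X\times Y$ with marginals $\mu$ and $\nu$; the systems are disjoint if $\int f(x)g(y)\,d\xi=\int f\,d\mu\cdot\int g\,d\nu$ for every joining $\xi$ and all bounded measurable complex functions $f$ on $X$ and $g$ on $Y$. For shift-invariant probability measures $\mu$ on $K^{\mathbb N}$ and $\nu$ on $L^{\mathbb N}$, where $K,L$ are finite subsets of the closed unit disc in $\mathbb C$, put $\mathrm{corr}(\mu,\nu)=\sup_\xi\bigl|\int x_1\overline{y_1}\,d\xi-\int x_1\,d\mu\cdot\int\overline{y_1}\,d\nu\bigr|$, the supremum being over all joinings $\xi$ of $\mu$ and $\nu$; the measures are uncorrelated if $\mathrm{corr}(\mu,\nu)=0$. Call $t\in\mathbb T$ ergodic if the rotation $s\mapsto s+t$ of $\mathbb T$ is ergodic for $ds$. (1) The measure $\lambda$ is $T$-invariant, almost every $t\in\mathbb T$ is ergodic,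 and $\lambda$ is disjoint from every ergodic probability measure-preserving system. (2) Let $K$ be a finite subset of the closed unit disc, let $P:\mathbb T^2\to K$ be measurable (a measurable finite partition of $\mathbb T^2$ with cells labelled by elements of $K$), let $\pi(z)=(P(T^{n-1}z))_{n\ge1}\in K^{\mathbb N}$, and let $\mu=\pi_*\lambda$. Then $\mu$ is a shift-invariant probability measure, $\pi$ is a factor map from $(\mathbb T^2,T,\lambda)$ to $K^{\mathbb N}$ with the shift and the measure $\mu$, $\mu$ is disjoint from every ergodic probability measure-preserving system, and $\mu$ is uncorrelated to every ergodic shift-invariant probability measure on $L^{\mathbb N}$, for every finite subset $L$ of the closed unit disc. Moreover $\mu=\int_{\mathbb T}\mu_t\,dt$, where $\mu_t$ is the image of $ds$ under $s\mapsto\pi(t,s)$, and $\mu_t$ is ergodic under the shift for every ergodic $t$. (3) Suppose in addition that $P$ partitions every ergodic circle nontrivially, i.e. for every ergodic $t$ and every $a\in K$ the set $\{s: P(t,s)=a\}$ does not have full measure. Then $\mu_t$ is not a point mass, for every ergodic $t$. If $K$ has at least two elements, such $P$ exist. -/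

import Mathlib

open MeasureTheory

/-- A joining of the measure-preserving systems `(X, T, μ)` and `(Y, S, ν)`: a `T × S`-invariant
measure on `X × Y` whose marginals are `μ` and `ν`. -/
structure IsJoining {X Y : Type*} [MeasurableSpace X] [MeasurableSpace Y]
    (T : X → X) (μ : Measure X) (S : Y → Y) (ν : Measure Y) (ξ : Measure (X × Y)) : Prop where
  map_fst : ξ.map Prod.fst = μ
  map_snd : ξ.map Prod.snd = ν
  invariant : MeasurePreserving (Prod.map T S) ξ ξ

/-- Disjointness in the sense of Furstenberg: `∫ f(x) g(y) dξ = ∫ f dμ · ∫ g dν` for every joining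
`ξ` and all bounded measurable functions `f` and `g`. -/
def FurstenbergDisjoint {X Y : Type*} [MeasurableSpace X] [MeasurableSpace Y]
    (T : X → X) (μ : Measure X) (S : Y → Y) (ν : Measure Y) : Prop :=
  ∀ ξ : Measure (X × Y), IsJoining T μ S ν ξ →
    ∀ (f : X → ℂ) (g : Y → ℂ), Measurable f → Measurable g →
      (∃ C : ℝ, ∀ x, ‖f x‖ ≤ C) → (∃ C : ℝ, ∀ y, ‖g y‖ ≤ C) →
      ∫ z, f z.1 * g z.2 ∂ξ = (∫ x, f x ∂μ) * ∫ y, g y ∂ν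

/-- The left shift on one-sided sequences. The first symbol of `x` is `x 0`. -/
def shift {A : Type*} (x : ℕ → A) : ℕ → A := fun n => x (n + 1)

/-- The correlation of shift-invariant measures `μ` on `K^ℕ` and `ν` on `L^ℕ` (`K`, `L` finite sets
of complex numbers): the supremum over all joinings `ξ` of
`|∫ x₁ conj(y₁) dξ - ∫ x₁ dμ · ∫ conj(y₁) dν|`, taken in `[0, ∞]`. -/
noncomputable def corr {K L : Finset ℂ} (μ : Measure (ℕ → K)) (ν : Measure (ℕ → L)) : ENNReal :=
  ⨆ (ξ : Measure ((ℕ → K) × (ℕ → L))) (_ : IsJoining shift μ shift ν ξ),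
    ‖(∫ z, (z.1 0 : ℂ) * starRingEnd ℂ (z.2 0 : ℂ) ∂ξ)
        - (∫ x, (x 0 : ℂ) ∂μ) * ∫ y, starRingEnd ℂ (y 0 : ℂ) ∂ν‖ₑ

/-- Two shift-invariant measures are uncorrelated if their correlation is zero. -/
def Uncorrelated {K L : Finset ℂ} (μ : Measure (ℕ → K)) (ν : Measure (ℕ → L)) : Prop :=
  corr μ ν = 0

/-- The two-dimensional torus `(ℝ/ℤ) × (ℝ/ℤ)`; its `volume` is the product `dt × ds` of the
normalized Lebesgue measures. -/
abbrev Torus2 : Type := UnitAddCircle × UnitAddCircle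

/-- The map `T(t, s) = (t, s + t)`. -/
def skewMap (z : Torus2) : Torus2 := (z.1, z.2 + z.1)

/-- The rotation by `t`, which is the action of `skewMap` on the invariant circle `{t} × (ℝ/ℤ)`. -/
def circleRotation (t : UnitAddCircle) (s : UnitAddCircle) : UnitAddCircle := s + t

/-- The itinerary of `z` under `skewMap` with respect to a labelled partition: `P z` is the label
of the cell that contains `z`. -/
def itinerary {K : Finset ℂ} (P : Torus2 → K) (z : Torus2) : ℕ → K :=
  fun n => P (skewMap^[n] z)

/-- The symbolic factor of the Lebesgue measure `dt × ds` induced by the partition `P`. -/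
noncomputable def symbolicFactor {K : Finset ℂ} (P : Torus2 → K) : Measure (ℕ → K) :=
  (volume : Measure Torus2).map (itinerary P)

/-- The image under the itinerary map of the normalized Lebesgue measure on the circle
`{t} × (ℝ/ℤ)`. -/
noncomputable def factorComponent {K : Finset ℂ} (P : Torus2 → K) (t : UnitAddCircle) :
    Measure (ℕ → K) :=
  (volume : Measure UnitAddCircle).map (fun s => itinerary P (t, s))

/-- The partition `P` is nontrivial (modulo null sets) on every circle `{t} × (ℝ/ℤ)` on which
`skewMap` is ergodic: no cell contains almost all of the circle. -/
def NontrivialOnErgodicCircles {K : Finset ℂ} (P : Torus2 → K) : Prop :=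
  ∀ t : UnitAddCircle, Ergodic (circleRotation t) (volume : Measure UnitAddCircle) →
    ∀ a : K, ¬ ∀ᵐ s : UnitAddCircle, P (t, s) = a

/-!
The coordinate `t` of `(t, s)` is invariant under `T`. A joining `η` of a factor of
`(𝕋², T, dt × ds)` with an ergodic system `(Y, S, ν)` lifts to a coupling `ξ` of `dt × ds` with
`ν` under which `(t, s)` and `y` are independent given the point of the factor. The conditional
probability of an event `{t ∈ A}` given this point is an invariant function on the factor;
weighting `η` by it yields an invariant measure whose second marginal is absolutely continuous
with respect to `ν`, hence a multiple of `ν` by ergodicity. So `t` and `y` are independent under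
`ξ`.

For `k ≠ 0`, evaluating `e(jt + ks) g(y)` at `(Tⁿ(t, s), Sⁿ y)` gives
`e(jt + ks) · e(knt) g(Sⁿ y)`. As `t` is uniformly distributed and independent of `y`, the
functions `e(knt) g(Sⁿ y)` are orthogonal in `L²(ξ)` and have the same norm, so by Bessel's
inequality the integrals `∫ e(jt + ks) · e(knt) g(Sⁿ y) dξ` tend to `0`; for `k = 0` they vanish
as soon as `∫ g dν = 0`. By density, `∫ F(Tⁿ(t, s)) g(Sⁿ y) dξ → 0` for every integrable `F`. If
`F` is a function on the factor, then this integral does not depend on `n`, because `η` is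
invariant; so it is `0`, which is disjointness.
-/

section Joinings

variable {X Y : Type*} [MeasurableSpace X] [MeasurableSpace Y] {T : X → X} {μ : Measure X}
  {S : Y → Y} {ν : Measure Y} {ξ : Measure (X × Y)}

lemma measurePreserving_withDensity_of_comp_ae_eq {φ : X → ENNReal} (hT : MeasurePreserving T μ μ)
    (hφ : Measurable φ) (hinv : φ ∘ T =ᵐ[μ] φ) :
    MeasurePreserving T (μ.withDensity φ) (μ.withDensity φ) := by
  refine ⟨hT.measurable, Measure.ext fun A hA => ?_⟩
  rw [Measure.map_apply hT.measurable hA, withDensity_apply _ (hT.measurable hA),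
    withDensity_apply _ hA, ← hT.setLIntegral_comp_preimage hA hφ]
  exact lintegral_congr_ae (ae_restrict_of_ae hinv.symm)

namespace IsJoining

lemma isProbabilityMeasure [IsProbabilityMeasure ν] (hξ : IsJoining T μ S ν ξ) :
    IsProbabilityMeasure ξ := by
  have : IsProbabilityMeasure (ξ.map Prod.snd) := by rwa [hξ.map_snd]
  exact Measure.isProbabilityMeasure_of_map Prod.snd

lemma setLIntegral_fst_of_invariant [IsProbabilityMeasure ν] (hξ : IsJoining T μ S ν ξ)
    (hS : Ergodic S ν) {φ : X → ENNReal} (hφ : Measurable φ) (hφ_fin : ∫⁻ x, φ x ∂μ ≠ ⊤)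
    (hinv : φ ∘ T =ᵐ[μ] φ) {B : Set Y} (hB : MeasurableSet B) :
    ∫⁻ w in Prod.snd ⁻¹' B, φ w.1 ∂ξ = (∫⁻ x, φ x ∂μ) * ν B := by
  have hfst : ∫⁻ w, φ w.1 ∂ξ = ∫⁻ x, φ x ∂μ := by
    rw [← hξ.map_fst, lintegral_map hφ measurable_fst]
  set ρ : Measure (X × Y) := ξ.withDensity (φ ∘ Prod.fst) with hρ
  have : IsFiniteMeasure ρ :=
    isFiniteMeasure_withDensity (by simpa only [Function.comp_apply, hfst] using hφ_fin)
  have hρ_inv : MeasurePreserving (Prod.map T S) ρ ρ :=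
    measurePreserving_withDensity_of_comp_ae_eq hξ.invariant (hφ.comp measurable_fst)
      (ae_eq_comp measurable_fst.aemeasurable (hξ.map_fst ▸ hinv))
  have hρS : MeasurePreserving S (ρ.map Prod.snd) (ρ.map Prod.snd) :=
    (measurable_snd.measurePreserving ρ).of_semiconj hρ_inv (fun _ => rfl) hS.measurable
  have hρν : ρ.map Prod.snd ≪ ν :=
    hξ.map_snd ▸ (withDensity_absolutelyContinuous ξ _).map measurable_snd
  obtain ⟨c, hc⟩ := hS.eq_smul_of_absolutelyContinuous hρS hρν
  have hmarginal {B : Set Y} (hB : MeasurableSet B) :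
      ∫⁻ w in Prod.snd ⁻¹' B, φ w.1 ∂ξ = c * ν B := by
    rw [← smul_eq_mul, ← Measure.smul_apply, ← hc, Measure.map_apply measurable_snd hB, hρ,
      withDensity_apply _ (measurable_snd hB)]
    rfl
  have hmass : ∫⁻ x, φ x ∂μ = c := by simpa [hfst] using hmarginal MeasurableSet.univ
  rw [hmass, hmarginal hB]

end IsJoining

end Joinings

section RelativelyIndependentCoupling

open ProbabilityTheory

variable {X Y Z : Type*} [MeasurableSpace X] [StandardBorelSpace X] [Nonempty X]
  [MeasurableSpace Y] [MeasurableSpace Z] {T : X → X} {μ : Measure X} [IsFiniteMeasure μ]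
  {S : Y → Y} {ν : Measure Y} {R : Z → Z} {p : X → Z} {η : Measure (Z × Y)}

lemma withDensity_condDistrib_id (hp : Measurable p) {D : Set X} (hD : MeasurableSet D) :
    (μ.map p).withDensity (fun z => condDistrib id p μ z D) = (μ.restrict D).map p := by
  refine Measure.ext fun B hB => ?_
  rw [withDensity_apply _ hB, setLIntegral_map hB (Kernel.measurable_coe _ hD) hp,
    setLIntegral_preimage_condDistrib hp measurable_id.aemeasurable hD hB,
    Measure.map_apply hp hB, Measure.restrict_apply (hp hB), Set.preimage_id]

lemma lintegral_condDistrib_id (hp : Measurable p) {D : Set X} (hD : MeasurableSet D) :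
    ∫⁻ z, condDistrib id p μ z D ∂μ.map p = μ D := by
  rw [← setLIntegral_univ, ← withDensity_apply _ .univ, withDensity_condDistrib_id hp hD,
    Measure.map_apply hp .univ, Set.preimage_univ, Measure.restrict_apply_univ]

lemma condDistrib_id_preimage_ae_eq_indicator (hp : Measurable p) {C : Set Z}
    (hC : MeasurableSet C) :
    (fun z => condDistrib id p μ z (p ⁻¹' C)) =ᵐ[μ.map p] C.indicator 1 := by
  refine (withDensity_eq_iff (Kernel.measurable_coe _ (hp hC)).aemeasurable
    (measurable_one.indicator hC).aemeasurable ?_).1 ?_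
  · rw [lintegral_condDistrib_id hp (hp hC)]
    exact measure_ne_top _ _
  · rw [withDensity_condDistrib_id hp (hp hC), withDensity_indicator_one hC,
      Measure.restrict_map hp hC]

lemma condDistrib_id_comp_ae_eq_of_invariant (hT : MeasurePreserving T μ μ) (hp : Measurable p)
    (hR : Measurable R) (hpR : Function.Semiconj p T R) {D : Set X} (hD : MeasurableSet D)
    (hTD : T ⁻¹' D = D) :
    (fun z => condDistrib id p μ z D) ∘ R =ᵐ[μ.map p] fun z => condDistrib id p μ z D := by
  set φ : Z → ENNReal := fun z => condDistrib id p μ z D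
  have hR_map : MeasurePreserving R (μ.map p) (μ.map p) :=
    (hp.measurePreserving μ).of_semiconj hT hpR hR
  have hT_restrict : MeasurePreserving T (μ.restrict D) (μ.restrict D) := by
    simpa only [hTD] using hT.restrict_preimage hD
  have hφ_map : (μ.map p).withDensity φ = (μ.restrict D).map p := withDensity_condDistrib_id hp hD
  have hR_density : MeasurePreserving R ((μ.map p).withDensity φ) ((μ.map p).withDensity φ) :=
    hφ_map ▸ (hp.measurePreserving _).of_semiconj hT_restrict hpR hR
  have : IsFiniteMeasure ((μ.map p).withDensity φ) := hφ_map ▸ inferInstance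
  have hrn := Measure.rnDeriv_withDensity (μ.map p) (f := φ) (Kernel.measurable_coe _ hD)
  filter_upwards [hR_density.rnDeriv_comp_aeEq hR_map, hrn,
    hR_map.quasiMeasurePreserving.ae_eq_comp hrn] with z hz_inv hz hRz
  exact hRz.symm.trans (hz_inv.trans hz)

/-- The coupling of `μ` with the second marginal of `η` that projects to `η` under `p × id` and
under which `x` and `y` are conditionally independent given `p x`: the first coordinate `z` of `η`
is replaced by a random point of the fibre `p⁻¹(z)`, drawn from the disintegration of `μ` over `p`.
It serves to lift a joining of a factor to a coupling of the whole system. -/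
noncomputable def relIndepCoupling (μ : Measure X) [IsFiniteMeasure μ] (p : X → Z)
    (η : Measure (Z × Y)) : Measure (X × Y) :=
  (condDistrib id p μ ∥ₖ Kernel.id) ∘ₘ η

lemma relIndepCoupling_prod {A : Set X} (hA : MeasurableSet A) {B : Set Y}
    (hB : MeasurableSet B) :
    relIndepCoupling μ p η (A ×ˢ B) = ∫⁻ w in Prod.snd ⁻¹' B, condDistrib id p μ w.1 A ∂η := by
  have hrect (w : Z × Y) : (condDistrib id p μ ∥ₖ (Kernel.id : Kernel Y Y)) w (A ×ˢ B) =
      (Prod.snd ⁻¹' B).indicator (fun w => condDistrib id p μ w.1 A) w := by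
    rw [Kernel.parallelComp_apply, Kernel.id_apply, Measure.prod_prod, Measure.dirac_apply' _ hB]
    by_cases hw : w.2 ∈ B <;> simp [hw]
  rw [relIndepCoupling, Measure.bind_apply (hA.prod hB) (Kernel.aemeasurable _)]
  simp only [hrect]
  exact lintegral_indicator (measurable_snd hB) _

lemma map_fst_relIndepCoupling (hp : Measurable p) (hη : η.map Prod.fst = μ.map p) :
    (relIndepCoupling μ p η).map Prod.fst = μ := by
  refine Measure.ext fun A hA => ?_
  rw [Measure.map_apply measurable_fst hA, ← Set.prod_univ, relIndepCoupling_prod hA .univ,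
    Set.preimage_univ, Measure.restrict_univ, ← lintegral_condDistrib_id hp hA, ← hη,
    lintegral_map (Kernel.measurable_coe _ hA) measurable_fst]

lemma map_prodMap_relIndepCoupling [IsFiniteMeasure η] (hp : Measurable p)
    (hη : η.map Prod.fst = μ.map p) :
    (relIndepCoupling μ p η).map (Prod.map p id) = η := by
  refine (Measure.ext_prod fun {C B} hC hB => ?_).symm
  have hfibre : (fun w : Z × Y => condDistrib id p μ w.1 (p ⁻¹' C)) =ᵐ[η]
      (Prod.fst ⁻¹' C).indicator 1 :=
    ae_eq_comp measurable_fst.aemeasurable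
      (hη ▸ condDistrib_id_preimage_ae_eq_indicator hp hC)
  rw [Measure.map_apply (hp.prodMap measurable_id) (hC.prod hB), Set.preimage_prod_map_prod,
    Set.preimage_id, relIndepCoupling_prod (hp hC) hB,
    lintegral_congr_ae (ae_restrict_of_ae hfibre), lintegral_indicator_one (measurable_fst hC),
    Measure.restrict_apply (measurable_fst hC), Set.prod_eq]

lemma IsJoining.map_prodMap_relIndepCoupling_of_invariant [IsProbabilityMeasure ν] {W : Type*}
    [MeasurableSpace W] {τ : X → W} (hη : IsJoining R (μ.map p) S ν η) (hS : Ergodic S ν)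
    (hT : MeasurePreserving T μ μ) (hp : Measurable p) (hR : Measurable R)
    (hpR : Function.Semiconj p T R) (hτ : Measurable τ) (hτT : τ ∘ T = τ) :
    (relIndepCoupling μ p η).map (Prod.map τ id) = (μ.map τ).prod ν := by
  refine (Measure.prod_eq fun A B hA hB => ?_).symm
  have hmass : ∫⁻ z, condDistrib id p μ z (τ ⁻¹' A) ∂μ.map p = μ (τ ⁻¹' A) :=
    lintegral_condDistrib_id hp (hτ hA)
  have hinv := condDistrib_id_comp_ae_eq_of_invariant hT hp hR hpR (hτ hA)
    (by rw [← Set.preimage_comp, hτT])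
  rw [Measure.map_apply (hτ.prodMap measurable_id) (hA.prod hB), Set.preimage_prod_map_prod,
    Set.preimage_id, relIndepCoupling_prod (hτ hA) hB,
    hη.setLIntegral_fst_of_invariant hS (Kernel.measurable_coe _ (hτ hA))
      (hmass.trans_ne (measure_ne_top _ _)) hinv hB, hmass, Measure.map_apply hτ hA]

end RelativelyIndependentCoupling

section Orthogonality

open Filter Topology
open scoped ComplexConjugate

lemma tendsto_inner_cofinite_zero_of_orthogonal {𝕜 E ι : Type*} [RCLike 𝕜]
    [NormedAddCommGroup E] [InnerProductSpace 𝕜 E] {u : ι → E} {c : ℝ}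
    (horth : Pairwise fun i j => inner 𝕜 (u i) (u j) = 0) (hnorm : ∀ i, ‖u i‖ = c) (v : E) :
    Tendsto (fun i => inner 𝕜 v (u i)) cofinite (𝓝 0) := by
  rcases eq_or_ne c 0 with rfl | hc
  · simpa [fun i => norm_eq_zero.1 (hnorm i)] using tendsto_const_nhds
  have hon : Orthonormal 𝕜 fun i => ((c : 𝕜)⁻¹ • u i) := by
    refine ⟨fun i => ?_, fun i j hij => ?_⟩
    · have : 0 ≤ c := hnorm i ▸ norm_nonneg _
      simp [norm_smul, hnorm, abs_of_nonneg this, hc]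
    · simp only [inner_smul_left, inner_smul_right, horth hij, mul_zero]
  have hsq := (hon.inner_products_summable v).tendsto_cofinite_zero
  have hbessel : Tendsto (fun i => ‖inner 𝕜 ((c : 𝕜)⁻¹ • u i) v‖) cofinite (𝓝 0) := by
    simpa using hsq.sqrt
  refine squeeze_zero_norm (fun i => ?_) (by simpa using hbessel.const_mul |c|)
  rw [inner_smul_left, norm_mul, norm_inner_symm]
  simp [hc]

lemma tendsto_integral_mul_cofinite_zero_of_orthogonal {Ω ι : Type*} [MeasurableSpace Ω]
    {μ : Measure Ω} {u : ι → Ω → ℂ} {v : Ω → ℂ} {c : ENNReal}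
    (horth : Pairwise fun i j => ∫ ω, conj (u i ω) * u j ω ∂μ = 0) (hu : ∀ i, MemLp (u i) 2 μ)
    (hnorm : ∀ i, eLpNorm (u i) 2 μ = c) (hv : MemLp v 2 μ) :
    Tendsto (fun i => ∫ ω, v ω * u i ω ∂μ) cofinite (𝓝 0) := by
  have hinner {f g : Ω → ℂ} (hf : MemLp f 2 μ) (hg : MemLp g 2 μ) :
      inner ℂ (hf.toLp f) (hg.toLp g) = ∫ ω, conj (f ω) * g ω ∂μ := by
    rw [L2.inner_def]
    refine integral_congr_ae ?_
    filter_upwards [hf.coeFn_toLp, hg.coeFn_toLp] with ω hfω hgω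
    rw [hfω, hgω, RCLike.inner_apply, mul_comm]
  have := tendsto_inner_cofinite_zero_of_orthogonal (𝕜 := ℂ) (u := fun i => (hu i).toLp (u i))
    (fun i j hij => (hinner (hu i) (hu j)).trans (horth hij))
    (fun i => by rw [Lp.norm_toLp, hnorm]) (hv.star.toLp _)
  simpa [hinner] using this

end Orthogonality

section SkewMap

instance : IsProbabilityMeasure (volume : Measure UnitAddCircle) :=
  ⟨UnitAddCircle.measure_univ⟩

instance : IsProbabilityMeasure (volume : Measure Torus2) :=
  inferInstanceAs (IsProbabilityMeasure ((volume : Measure UnitAddCircle).prod volume))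

lemma measurePreserving_skewMap : MeasurePreserving skewMap (volume : Measure Torus2) volume :=
  (MeasurePreserving.id volume).skew_product (g := fun t s : UnitAddCircle => s + t)
    (measurable_snd.add measurable_fst)
    (Filter.Eventually.of_forall fun t => (measurePreserving_add_right volume t).map_eq)

lemma measurable_skewMap : Measurable skewMap := measurePreserving_skewMap.measurable

lemma skewMap_iterate (n : ℕ) (z : Torus2) : skewMap^[n] z = (z.1, z.2 + n • z.1) := by
  induction n with
  | zero => simp
  | succ n ih => rw [Function.iterate_succ_apply', ih, skewMap, succ_nsmul, add_assoc]

end SkewMap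

section Characters

lemma integral_fourier_eq_zero {n : ℤ} (hn : n ≠ 0) :
    ∫ t : UnitAddCircle, (fourier n t : ℂ) = 0 :=
  integral_eq_zero_of_add_right_eq_neg (fourier_add_half_inv_index hn one_pos)

lemma norm_fourier_apply (n : ℤ) (t : UnitAddCircle) : ‖(fourier n t : ℂ)‖ = 1 := by
  rw [fourier_apply, Circle.norm_coe]

lemma fourier_add_nsmul (k : ℤ) (n : ℕ) (s t : UnitAddCircle) :
    (fourier k (s + n • t) : ℂ) = fourier k s * fourier (k * n) t := by
  simp only [fourier_apply, ← natCast_zsmul, smul_add, AddCircle.toCircle_add, Circle.coe_mul,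
    mul_smul]

/-- The character `(t, s) ↦ e(jt + ks)` of the torus, indexed by `m = (j, k)`. -/
noncomputable def torusCharacter (m : ℤ × ℤ) : C(Torus2, ℂ) where
  toFun z := fourier m.1 z.1 * fourier m.2 z.2

lemma span_torusCharacter_closure_eq_top :
    (Submodule.span ℂ (Set.range torusCharacter)).topologicalClosure = ⊤ := by
  let h : C(Torus2, UnitAddTorus (Fin 2)) := ⟨fun z => ![z.1, z.2], by fun_prop⟩
  let L : C(UnitAddTorus (Fin 2), ℂ) →L[ℂ] C(Torus2, ℂ) :=
    ⟨(ContinuousMap.compRightAlgHom ℂ ℂ h).toLinearMap,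
      ContinuousMap.compRightAlgHom_continuous ℂ ℂ h⟩
  have hL : Function.Surjective L := fun q => ⟨⟨fun x => q (x 0, x 1), by fun_prop⟩, rfl⟩
  have hmap : (Submodule.span ℂ (Set.range UnitAddTorus.mFourier)).map L.toLinearMap ≤
      Submodule.span ℂ (Set.range torusCharacter) := by
    rw [Submodule.map_span_le]
    rintro _ ⟨m, rfl⟩
    refine Submodule.subset_span ⟨(m 0, m 1), ContinuousMap.ext fun z => ?_⟩
    simp [torusCharacter, UnitAddTorus.mFourier, L, h]
  rw [eq_top_iff, ← LinearMap.range_eq_top.2 hL, ← Submodule.map_top,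
    ← UnitAddTorus.span_mFourier_closure_eq_top]
  exact (Submodule.topologicalClosure_map L _).trans (Submodule.topologicalClosure_mono hmap)

lemma exists_mem_span_torusCharacter_integral_norm_sub_le {F : Torus2 → ℂ}
    (hF : Integrable F) {ε : ℝ} (hε : 0 < ε) :
    ∃ p ∈ Submodule.span ℂ (Set.range torusCharacter), ∫ z, ‖F z - p z‖ ≤ ε := by
  obtain ⟨q, hFq, hq⟩ := hF.exists_boundedContinuous_integral_sub_le (half_pos hε)
  have hclosure : q.toContinuousMap ∈ closure
      (Submodule.span ℂ (Set.range torusCharacter) : Set C(Torus2, ℂ)) := by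
    rw [← Submodule.topologicalClosure_coe, span_torusCharacter_closure_eq_top]
    trivial
  obtain ⟨p, hp, hqp⟩ := Metric.mem_closure_iff.1 hclosure (ε / 2) (half_pos hε)
  have hp_int : Integrable p := p.continuous.integrable_of_hasCompactSupport (.of_compactSpace _)
  have hqp_apply (z : Torus2) : ‖q z - p z‖ ≤ ε / 2 :=
    dist_eq_norm (q z) (p z) ▸ (ContinuousMap.dist_apply_le_dist z).trans hqp.le
  refine ⟨p, hp, ?_⟩
  calc ∫ z, ‖F z - p z‖ ≤ ∫ z, (‖F z - q z‖ + ε / 2) :=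
        integral_mono (hF.sub hp_int).norm ((hF.sub hq).norm.add (integrable_const _)) fun z =>
          (norm_sub_le_norm_sub_add_norm_sub _ (q z) _).trans (add_le_add_right (hqp_apply z) _)
    _ = (∫ z, ‖F z - q z‖) + ε / 2 := by
        rw [integral_add (f := fun z => ‖F z - q z‖) (hF.sub hq).norm (integrable_const _)]
        simp
    _ ≤ ε := by linarith

end Characters

section Mixing

open Filter Topology
open scoped ComplexConjugate

variable {Y : Type*} [MeasurableSpace Y] {S : Y → Y} {ν : Measure Y} {ξ : Measure (Torus2 × Y)}
  {g : Y → ℂ} {C : ℝ}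

/-- `ξ` is a coupling of `dt × ds` with `ν` under which the invariant coordinate `t` is independent
of `y`. Nothing is required of the joint law of `s` and `y`, and `ξ` need not be invariant. -/
structure IsBaseIndependent (ν : Measure Y) (ξ : Measure (Torus2 × Y)) : Prop where
  map_fst : ξ.map Prod.fst = volume
  map_base : ξ.map (Prod.map Prod.fst id) = (volume : Measure UnitAddCircle).prod ν

namespace IsBaseIndependent

lemma isProbabilityMeasure (hξ : IsBaseIndependent ν ξ) : IsProbabilityMeasure ξ := by
  have : IsProbabilityMeasure (ξ.map Prod.fst) := by
    rw [hξ.map_fst]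
    infer_instance
  exact Measure.isProbabilityMeasure_of_map Prod.fst

lemma measurePreserving_fst (hξ : IsBaseIndependent ν ξ) :
    MeasurePreserving Prod.fst ξ volume :=
  ⟨measurable_fst, hξ.map_fst⟩

lemma norm_integral_iterate_mul_le (hξ : IsBaseIndependent ν ξ) {F : Torus2 → ℂ}
    (hF : Integrable F) (hg : ∀ y, ‖g y‖ ≤ C) (n : ℕ) :
    ‖∫ w, F (skewMap^[n] w.1) * g (S^[n] w.2) ∂ξ‖ ≤ C * ∫ z, ‖F z‖ := by
  have hmp : MeasurePreserving (fun w : Torus2 × Y => skewMap^[n] w.1) ξ volume :=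
    (measurePreserving_skewMap.iterate n).comp hξ.measurePreserving_fst
  have hint : Integrable (fun w : Torus2 × Y => ‖F (skewMap^[n] w.1)‖) ξ :=
    (hmp.integrable_comp_of_integrable hF).norm
  calc ‖∫ w, F (skewMap^[n] w.1) * g (S^[n] w.2) ∂ξ‖
      ≤ ∫ w, C * ‖F (skewMap^[n] w.1)‖ ∂ξ := by
        refine norm_integral_le_of_norm_le (hint.const_mul C) (.of_forall fun w => ?_)
        rw [norm_mul, mul_comm]
        gcongr
        exact hg _
    _ = C * ∫ z, ‖F z‖ := by
        rw [integral_const_mul, ← hmp.map_eq,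
          integral_map hmp.aemeasurable (hmp.map_eq.symm ▸ hF.norm.1)]

section SFinite

variable [SFinite ν]

lemma measurePreserving_snd (hξ : IsBaseIndependent ν ξ) : MeasurePreserving Prod.snd ξ ν :=
  (MeasureTheory.measurePreserving_snd (μ := (volume : Measure UnitAddCircle)) (ν := ν)).comp
    (⟨measurable_fst.prodMap measurable_id, hξ.map_base⟩ : MeasurePreserving (Prod.map _ id) ξ _)

lemma integral_fst_mul_snd (hξ : IsBaseIndependent ν ξ) {a : UnitAddCircle → ℂ} {b : Y → ℂ}
    (ha : AEStronglyMeasurable a volume) (hb : AEStronglyMeasurable b ν) :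
    ∫ w, a w.1.1 * b w.2 ∂ξ = (∫ t, a t) * ∫ y, b y ∂ν := by
  have hmeas : AEStronglyMeasurable (fun w : UnitAddCircle × Y => a w.1 * b w.2)
      (ξ.map (Prod.map Prod.fst id)) := hξ.map_base ▸ ha.comp_fst.mul hb.comp_snd
  rw [← integral_prod_mul, ← hξ.map_base, integral_map (by fun_prop) hmeas]
  rfl

lemma tendsto_integral_mul_fourier_mul_iterate (hξ : IsBaseIndependent ν ξ)
    (hS : MeasurePreserving S ν ν) (hg : MemLp g 2 ν) {k : ℤ} (hk : k ≠ 0)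
    {v : Torus2 × Y → ℂ} (hv : MemLp v 2 ξ) :
    Tendsto (fun n : ℕ => ∫ w, v w * (fourier (k * n) w.1.1 * g (S^[n] w.2)) ∂ξ)
      atTop (𝓝 0) := by
  have hgS (n : ℕ) : AEStronglyMeasurable (fun y => g (S^[n] y)) ν :=
    hg.1.comp_measurePreserving (hS.iterate n)
  have hfourier (k : ℤ) : Continuous (fourier k : UnitAddCircle → ℂ) := map_continuous _
  have hu (n : ℕ) : AEStronglyMeasurable (fun w => fourier (k * n) w.1.1 * g (S^[n] w.2)) ξ :=
    ((hfourier _).comp_aestronglyMeasurable (by fun_prop)).mul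
      ((hgS n).comp_measurePreserving hξ.measurePreserving_snd)
  have hnorm (n : ℕ) :
      eLpNorm (fun w => fourier (k * n) w.1.1 * g (S^[n] w.2)) 2 ξ = eLpNorm g 2 ν := by
    rw [← eLpNorm_comp_measurePreserving hg.1 ((hS.iterate n).comp hξ.measurePreserving_snd)]
    refine eLpNorm_congr_norm_ae (Eventually.of_forall fun w => ?_)
    simp only [norm_mul, norm_fourier_apply, one_mul, Function.comp_apply]
  have horth {m n : ℕ} (hmn : m ≠ n) : ∫ w, conj (fourier (k * m) w.1.1 * g (S^[m] w.2)) *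
      (fourier (k * n) w.1.1 * g (S^[n] w.2)) ∂ξ = 0 := by
    have hkmn : k * n - k * m ≠ 0 :=
      mul_sub k n m ▸ mul_ne_zero hk (sub_ne_zero.2 (by exact_mod_cast hmn.symm))
    calc ∫ w, conj (fourier (k * m) w.1.1 * g (S^[m] w.2)) *
          (fourier (k * n) w.1.1 * g (S^[n] w.2)) ∂ξ
        = ∫ w, fourier (k * n - k * m) w.1.1 * (conj (g (S^[m] w.2)) * g (S^[n] w.2)) ∂ξ := by
          congr with w
          rw [sub_eq_neg_add, fourier_add, fourier_neg, map_mul]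
          ring
      _ = (∫ t, fourier (k * n - k * m) t) * ∫ y, conj (g (S^[m] y)) * g (S^[n] y) ∂ν :=
          hξ.integral_fst_mul_snd (hfourier _).aestronglyMeasurable ((hgS m).star.mul (hgS n))
      _ = 0 := by rw [integral_fourier_eq_zero hkmn, zero_mul]
  rw [← Nat.cofinite_eq_atTop]
  exact tendsto_integral_mul_cofinite_zero_of_orthogonal (fun _ _ => horth)
    (fun n => ⟨hu n, (hnorm n).trans_lt hg.2⟩) hnorm hv

lemma tendsto_integral_torusCharacter_mul_iterate (hξ : IsBaseIndependent ν ξ)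
    (hS : MeasurePreserving S ν ν) (hg : MemLp g 2 ν)
    (hg₀ : ∫ y, g y ∂ν = 0) (m : ℤ × ℤ) :
    Tendsto (fun n => ∫ w, torusCharacter m (skewMap^[n] w.1) * g (S^[n] w.2) ∂ξ)
      atTop (𝓝 0) := by
  have := hξ.isProbabilityMeasure
  rcases eq_or_ne m.2 0 with hk | hk
  · refine tendsto_const_nhds.congr fun n => ?_
    calc (0 : ℂ) = (∫ t, fourier m.1 t) * ∫ y, g (S^[n] y) ∂ν := by
          rw [← integral_map (hS.iterate n).aemeasurable ((hS.iterate n).map_eq.symm ▸ hg.1),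
            (hS.iterate n).map_eq, hg₀, mul_zero]
      _ = ∫ w, fourier m.1 w.1.1 * g (S^[n] w.2) ∂ξ :=
          (hξ.integral_fst_mul_snd (map_continuous _).aestronglyMeasurable
            (hg.1.comp_measurePreserving (hS.iterate n))).symm
      _ = ∫ w, torusCharacter m (skewMap^[n] w.1) * g (S^[n] w.2) ∂ξ := by
          simp [torusCharacter, hk, skewMap_iterate]
  · have hv : MemLp (fun w : Torus2 × Y => torusCharacter m w.1) 2 ξ :=
      .of_bound ((map_continuous _).comp_aestronglyMeasurable (by fun_prop)) 1
        (.of_forall fun w => by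
          simp only [torusCharacter, ContinuousMap.coe_mk, norm_mul, norm_fourier_apply, mul_one,
            le_refl])
    refine (hξ.tendsto_integral_mul_fourier_mul_iterate hS hg hk hv).congr fun n => ?_
    congr with w
    simp only [torusCharacter, ContinuousMap.coe_mk, skewMap_iterate, fourier_add_nsmul]
    ring

lemma integrable_iterate_mul (hξ : IsBaseIndependent ν ξ) (hS : MeasurePreserving S ν ν)
    {F : Torus2 → ℂ} (hF : Integrable F) (hgm : AEStronglyMeasurable g ν) (hg : ∀ y, ‖g y‖ ≤ C)
    (n : ℕ) : Integrable (fun w => F (skewMap^[n] w.1) * g (S^[n] w.2)) ξ :=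
  (((measurePreserving_skewMap.iterate n).comp
    hξ.measurePreserving_fst).integrable_comp_of_integrable hF).mul_bdd
    (hgm.comp_measurePreserving ((hS.iterate n).comp hξ.measurePreserving_snd))
    (.of_forall fun _ => hg _)

end SFinite

variable [IsFiniteMeasure ν]

lemma tendsto_integral_mul_iterate_of_mem_span (hξ : IsBaseIndependent ν ξ)
    (hS : MeasurePreserving S ν ν) (hgm : AEStronglyMeasurable g ν) (hg : ∀ y, ‖g y‖ ≤ C)
    (hg₀ : ∫ y, g y ∂ν = 0) {p : C(Torus2, ℂ)}
    (hp : p ∈ Submodule.span ℂ (Set.range torusCharacter)) :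
    Tendsto (fun n => ∫ w, p (skewMap^[n] w.1) * g (S^[n] w.2) ∂ξ) atTop (𝓝 0) := by
  have hint (q : C(Torus2, ℂ)) (n : ℕ) :
      Integrable (fun w => q (skewMap^[n] w.1) * g (S^[n] w.2)) ξ :=
    hξ.integrable_iterate_mul hS
      (q.continuous.integrable_of_hasCompactSupport (.of_compactSpace _)) hgm hg n
  induction hp using Submodule.span_induction with
  | mem q hq =>
    obtain ⟨m, rfl⟩ := hq
    exact hξ.tendsto_integral_torusCharacter_mul_iterate hS (.of_bound hgm C (.of_forall hg)) hg₀ m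
  | zero => simp
  | add q r _ _ hq hr =>
    simpa only [ContinuousMap.add_apply, add_mul, integral_add (hint q _) (hint r _), add_zero]
      using hq.add hr
  | smul c q _ hq =>
    simpa only [ContinuousMap.smul_apply, smul_mul_assoc, integral_smul, smul_zero]
      using hq.const_smul c

theorem tendsto_integral_iterate_mul_iterate (hξ : IsBaseIndependent ν ξ)
    (hS : MeasurePreserving S ν ν) (hgm : AEStronglyMeasurable g ν) (hg : ∀ y, ‖g y‖ ≤ C)
    (hg₀ : ∫ y, g y ∂ν = 0) {F : Torus2 → ℂ} (hF : Integrable F) :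
    Tendsto (fun n => ∫ w, F (skewMap^[n] w.1) * g (S^[n] w.2) ∂ξ) atTop (𝓝 0) := by
  refine NormedAddGroup.tendsto_nhds_zero.2 fun ε hε => ?_
  have hC : 0 < |C| + 1 := by positivity
  obtain ⟨p, hp, hFp⟩ := exists_mem_span_torusCharacter_integral_norm_sub_le hF
    (div_pos (half_pos hε) hC)
  have hp_int : Integrable p := p.continuous.integrable_of_hasCompactSupport (.of_compactSpace _)
  have hlim := hξ.tendsto_integral_mul_iterate_of_mem_span hS hgm hg hg₀ hp
  filter_upwards [NormedAddGroup.tendsto_nhds_zero.1 hlim (ε / 2) (half_pos hε)] with n hn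
  have hsplit : ∫ w, F (skewMap^[n] w.1) * g (S^[n] w.2) ∂ξ =
      (∫ w, (F - p) (skewMap^[n] w.1) * g (S^[n] w.2) ∂ξ) +
        ∫ w, p (skewMap^[n] w.1) * g (S^[n] w.2) ∂ξ := by
    rw [← integral_add (hξ.integrable_iterate_mul hS (hF.sub hp_int) hgm hg n)
      (hξ.integrable_iterate_mul hS hp_int hgm hg n)]
    simp only [Pi.sub_apply, sub_mul, sub_add_cancel]
  have herror : ‖∫ w, (F - p) (skewMap^[n] w.1) * g (S^[n] w.2) ∂ξ‖ ≤ ε / 2 :=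
    calc _ ≤ C * ∫ z, ‖(F - p) z‖ := hξ.norm_integral_iterate_mul_le (hF.sub hp_int) hg n
      _ ≤ (|C| + 1) * (ε / 2 / (|C| + 1)) := by
        gcongr
        · linarith [le_abs_self C]
        · exact hFp
      _ = ε / 2 := mul_div_cancel₀ _ hC.ne'
  rw [hsplit]
  linarith [norm_add_le (∫ w, (F - p) (skewMap^[n] w.1) * g (S^[n] w.2) ∂ξ)
    (∫ w, p (skewMap^[n] w.1) * g (S^[n] w.2) ∂ξ)]

end IsBaseIndependent

end Mixing

section Disjointness

variable {Y Z : Type*} [MeasurableSpace Y] [MeasurableSpace Z] {S : Y → Y} {ν : Measure Y}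
  [IsProbabilityMeasure ν] {R : Z → Z} {p : Torus2 → Z} {η : Measure (Z × Y)}

lemma IsJoining.isBaseIndependent_relIndepCoupling (hη : IsJoining R (volume.map p) S ν η)
    (hS : Ergodic S ν) (hp : Measurable p) (hR : Measurable R)
    (hpR : Function.Semiconj p skewMap R) : IsBaseIndependent ν (relIndepCoupling volume p η) where
  map_fst := by
    have := hη.isProbabilityMeasure
    exact map_fst_relIndepCoupling hp hη.map_fst
  map_base := by
    rw [hη.map_prodMap_relIndepCoupling_of_invariant hS measurePreserving_skewMap hp hR hpR
      measurable_fst rfl, Measure.volume_eq_prod, measurePreserving_fst.map_eq]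

lemma IsJoining.integral_mul_eq_zero_of_semiconj_skewMap (hη : IsJoining R (volume.map p) S ν η)
    (hS : Ergodic S ν) (hp : Measurable p) (hR : Measurable R)
    (hpR : Function.Semiconj p skewMap R) {f : Z → ℂ} {g : Y → ℂ} {C D : ℝ} (hf : Measurable f)
    (hg : Measurable g) (hfC : ∀ z, ‖f z‖ ≤ C) (hgD : ∀ y, ‖g y‖ ≤ D) (hg₀ : ∫ y, g y ∂ν = 0) :
    ∫ w, f w.1 * g w.2 ∂η = 0 := by
  have := hη.isProbabilityMeasure
  have hlift : MeasurePreserving (Prod.map p id) (relIndepCoupling volume p η) η :=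
    ⟨hp.prodMap measurable_id, map_prodMap_relIndepCoupling hp hη.map_fst⟩
  have hconst (n : ℕ) : ∫ w, f (p (skewMap^[n] w.1)) * g (S^[n] w.2) ∂relIndepCoupling volume p η =
      ∫ w, f w.1 * g w.2 ∂η := by
    have hn := (hη.invariant.iterate n).comp hlift
    conv_rhs => rw [← hn.map_eq]
    rw [integral_map hn.aemeasurable (by fun_prop)]
    simp only [Function.comp_apply, Prod.map_iterate, Prod.map_fst, Prod.map_snd, id_eq,
      (hpR.iterate_right n).eq]
  have hfp : Integrable (fun z => f (p z)) :=
    .of_bound (hf.comp hp).aestronglyMeasurable C (.of_forall fun z => hfC (p z))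
  have hlim :=
    (hη.isBaseIndependent_relIndepCoupling hS hp hR hpR).tendsto_integral_iterate_mul_iterate
    hS.toMeasurePreserving hg.aestronglyMeasurable hgD hg₀ hfp
  exact tendsto_nhds_unique (tendsto_const_nhds.congr fun n => (hconst n).symm) hlim

theorem furstenbergDisjoint_map_of_semiconj_skewMap (hS : Ergodic S ν) (hp : Measurable p)
    (hR : Measurable R) (hpR : Function.Semiconj p skewMap R) :
    FurstenbergDisjoint R (volume.map p) S ν := by
  rintro η hη f g hf hg ⟨C, hfC⟩ ⟨D, hgD⟩
  have := hη.isProbabilityMeasure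
  set m := ∫ y, g y ∂ν
  have hg_int : Integrable g ν := .of_bound hg.aestronglyMeasurable D (.of_forall hgD)
  have hfη : Integrable (fun w : Z × Y => f w.1) η :=
    .of_bound (hf.comp measurable_fst).aestronglyMeasurable C (.of_forall fun w => hfC w.1)
  have hfgη : Integrable (fun w : Z × Y => f w.1 * g w.2) η :=
    hfη.mul_bdd (hg.comp measurable_snd).aestronglyMeasurable (.of_forall fun w => hgD w.2)
  have hcentered : ∫ w, f w.1 * (g w.2 - m) ∂η = 0 :=
    hη.integral_mul_eq_zero_of_semiconj_skewMap hS hp hR hpR hf (hg.sub_const m) hfC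
      (fun y => (norm_sub_le _ _).trans (add_le_add_left (hgD y) _))
      (by simp [integral_sub hg_int (integrable_const m), m])
  simp only [mul_sub] at hcentered
  rw [integral_sub hfgη (hfη.mul_const m), integral_mul_const, sub_eq_zero] at hcentered
  rw [hcentered, ← hη.map_fst, integral_map measurable_fst.aemeasurable hf.aestronglyMeasurable]

theorem furstenbergDisjoint_skewMap (hS : Ergodic S ν) :
    FurstenbergDisjoint skewMap volume S ν := by
  simpa only [Measure.map_id] using furstenbergDisjoint_map_of_semiconj_skewMap hS measurable_id
    measurable_skewMap Function.Semiconj.id_left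

end Disjointness

section Partitions

instance : NullSingletonClass (volume : Measure UnitAddCircle) :=
  ⟨fun x => by rw [← Metric.closedBall_zero, AddCircle.volume_closedBall]; simp⟩

lemma ae_ergodic_circleRotation :
    ∀ᵐ t : UnitAddCircle, Ergodic (circleRotation t) (volume : Measure UnitAddCircle) := by
  have htorsion : ∀ᵐ t : UnitAddCircle, ∀ n : ℕ, 0 < n → n • t ≠ 0 := by
    refine ae_all_iff.2 fun n => Filter.eventually_imp_distrib_left.2 fun hn => ?_
    exact measure_eq_zero_iff_ae_notMem.1
      ((AddCircle.finite_torsion (1 : ℝ) hn).measure_zero volume)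
  filter_upwards [htorsion] with t ht
  exact AddCircle.ergodic_add_right.2 (addOrderOf_eq_zero_iff'.2 ht)

lemma exists_nontrivialOnErgodicCircles {K : Finset ℂ} (hK : 2 ≤ K.card) :
    ∃ P : Torus2 → K, Measurable P ∧ NontrivialOnErgodicCircles P := by
  classical
  obtain ⟨a, ha, b, hb, hab⟩ := Finset.one_lt_card.1 hK
  let E : Set UnitAddCircle := Metric.closedBall 0 (1 / 4)
  have hE : MeasurableSet E := Metric.isClosed_closedBall.measurableSet
  have hvol : volume E = ENNReal.ofReal (1 / 2) := by
    rw [AddCircle.volume_closedBall]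
    norm_num
  have hE_freq : ∃ᶠ s in ae volume, s ∈ E := frequently_ae_mem_iff.2 (by simp [hvol])
  have hEc_freq : ∃ᶠ s in ae volume, s ∈ Eᶜ := by
    rw [frequently_ae_mem_iff, Ne, prob_compl_eq_zero_iff hE, hvol]
    norm_num
  refine ⟨fun z => if z.2 ∈ E then ⟨a, ha⟩ else ⟨b, hb⟩,
    Measurable.ite (measurable_snd hE) measurable_const measurable_const, fun t _ c hc => ?_⟩
  obtain ⟨s, hsE, hs⟩ := (hE_freq.and_eventually hc).exists
  obtain ⟨s', hsE', hs'⟩ := (hEc_freq.and_eventually hc).exists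
  have hac : ⟨a, ha⟩ = c := (if_pos hsE).symm.trans hs
  have hbc : ⟨b, hb⟩ = c := (if_neg hsE').symm.trans hs'
  exact hab (congrArg Subtype.val (hac.trans hbc.symm))

end Partitions

section Itinerary

variable {K : Finset ℂ} {P : Torus2 → K}

lemma measurable_itinerary (hP : Measurable P) : Measurable (itinerary P) :=
  measurable_pi_lambda _ fun n => hP.comp (measurable_skewMap.iterate n)

lemma measurable_shift : Measurable (shift : (ℕ → K) → ℕ → K) :=
  measurable_pi_lambda _ fun n => measurable_pi_apply (n + 1)

lemma semiconj_itinerary (P : Torus2 → K) : Function.Semiconj (itinerary P) skewMap shift :=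
  fun z => funext fun n => congrArg P (Function.iterate_succ_apply skewMap n z).symm

lemma measurePreserving_itinerary (hP : Measurable P) :
    MeasurePreserving (itinerary P) (volume : Measure Torus2) (symbolicFactor P) :=
  ⟨measurable_itinerary hP, rfl⟩

lemma isProbabilityMeasure_symbolicFactor (hP : Measurable P) :
    IsProbabilityMeasure (symbolicFactor P) :=
  Measure.isProbabilityMeasure_map (measurable_itinerary hP).aemeasurable

lemma measurePreserving_shift_symbolicFactor (hP : Measurable P) :
    MeasurePreserving shift (symbolicFactor P) (symbolicFactor P) :=
  (measurePreserving_itinerary hP).of_semiconj measurePreserving_skewMap (semiconj_itinerary P)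
    measurable_shift

lemma measurable_itinerary_circle (hP : Measurable P) (t : UnitAddCircle) :
    Measurable fun s => itinerary P (t, s) :=
  (measurable_itinerary hP).comp measurable_prodMk_left

lemma symbolicFactor_apply (hP : Measurable P) {E : Set (ℕ → K)} (hE : MeasurableSet E) :
    symbolicFactor P E = ∫⁻ t : UnitAddCircle, factorComponent P t E := by
  rw [symbolicFactor, Measure.map_apply (measurable_itinerary hP) hE, Measure.volume_eq_prod,
    Measure.prod_apply (measurable_itinerary hP hE)]
  refine lintegral_congr fun t => ?_
  rw [factorComponent, Measure.map_apply (measurable_itinerary_circle hP t) hE]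
  rfl

lemma ergodic_factorComponent (hP : Measurable P) {t : UnitAddCircle}
    (ht : Ergodic (circleRotation t) (volume : Measure UnitAddCircle)) :
    Ergodic shift (factorComponent P t) :=
  MeasurePreserving.ergodic_of_ergodic_semiconj
    (g := fun s => itinerary P (t, s)) ⟨measurable_itinerary_circle hP t, rfl⟩ ht measurable_shift
    fun s => semiconj_itinerary P (t, s)

lemma factorComponent_ne_dirac (hP : Measurable P) (hn : NontrivialOnErgodicCircles P)
    {t : UnitAddCircle} (ht : Ergodic (circleRotation t) (volume : Measure UnitAddCircle))
    (x : ℕ → K) : factorComponent P t ≠ Measure.dirac x := by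
  intro h
  refine hn t ht (x 0) ?_
  have hs : MeasurableSet {y : ℕ → K | y 0 = x 0} :=
    measurableSet_eq_fun (measurable_pi_apply 0) measurable_const
  have h_first : ∀ᵐ y ∂factorComponent P t, y 0 = x 0 := by
    rw [h, ae_dirac_iff hs]
  exact ae_of_ae_map (measurable_itinerary_circle hP t).aemeasurable h_first

lemma furstenbergDisjoint_symbolicFactor {Y : Type*} [MeasurableSpace Y] {S : Y → Y}
    {ν : Measure Y} [IsProbabilityMeasure ν] (hS : Ergodic S ν) (hP : Measurable P) :
    FurstenbergDisjoint shift (symbolicFactor P) S ν :=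
  furstenbergDisjoint_map_of_semiconj_skewMap hS (measurable_itinerary hP) measurable_shift
    (semiconj_itinerary P)

lemma FurstenbergDisjoint.uncorrelated {L : Finset ℂ} (hK : ∀ a ∈ K, ‖a‖ ≤ 1)
    (hL : ∀ b ∈ L, ‖b‖ ≤ 1) {μ : Measure (ℕ → K)} {ν : Measure (ℕ → L)}
    (h : FurstenbergDisjoint shift μ shift ν) : Uncorrelated μ ν := by
  refine le_antisymm (iSup₂_le fun ξ hξ => ?_) bot_le
  rw [h ξ hξ (fun x => (x 0 : ℂ)) (fun y => starRingEnd ℂ (y 0 : ℂ))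
    (measurable_subtype_coe.comp (measurable_pi_apply 0))
    (Complex.continuous_conj.measurable.comp
      (measurable_subtype_coe.comp (measurable_pi_apply 0)))
    ⟨1, fun x => hK _ (x 0).2⟩ ⟨1, fun y => by rw [RCLike.norm_conj]; exact hL _ (y 0).2⟩]
  simp

end Itinerary

theorem mainTheorem10 :
    -- the Lebesgue measure is invariant and almost all of its invariant circles are ergodic
    MeasurePreserving skewMap (volume : Measure Torus2) volume ∧
    (∀ᵐ t : UnitAddCircle, Ergodic (circleRotation t) (volume : Measure UnitAddCircle)) ∧
    -- the Lebesgue measure is disjoint from every ergodic measure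
    (∀ (Y : Type*) [MeasurableSpace Y] (S : Y → Y) (ν : Measure Y) [IsProbabilityMeasure ν],
      Ergodic S ν → FurstenbergDisjoint skewMap (volume : Measure Torus2) S ν) ∧
    -- partitions that are nontrivial on every ergodic circle exist
    (∀ K : Finset ℂ, (∀ a ∈ K, ‖a‖ ≤ 1) → 2 ≤ K.card →
      ∃ P : Torus2 → K, Measurable P ∧ NontrivialOnErgodicCircles P) ∧
    -- the symbolic factors
    (∀ K : Finset ℂ, (∀ a ∈ K, ‖a‖ ≤ 1) → ∀ P : Torus2 → K, Measurable P →
      IsProbabilityMeasure (symbolicFactor P) ∧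
      MeasurePreserving shift (symbolicFactor P) (symbolicFactor P) ∧
      MeasurePreserving (itinerary P) (volume : Measure Torus2) (symbolicFactor P) ∧
      Function.Semiconj (itinerary P) skewMap shift ∧
      (∀ (Y : Type*) [MeasurableSpace Y] (S : Y → Y) (ν : Measure Y) [IsProbabilityMeasure ν],
        Ergodic S ν → FurstenbergDisjoint shift (symbolicFactor P) S ν) ∧
      (∀ L : Finset ℂ, (∀ b ∈ L, ‖b‖ ≤ 1) →
        ∀ (ν : Measure (ℕ → L)) [IsProbabilityMeasure ν], Ergodic shift ν →
          Uncorrelated (symbolicFactor P) ν) ∧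
      -- the ergodic components of the factor, nontrivial if the partition is
      (∀ E : Set (ℕ → K), MeasurableSet E →
        symbolicFactor P E = ∫⁻ t : UnitAddCircle, factorComponent P t E) ∧
      (∀ t : UnitAddCircle, Ergodic (circleRotation t) (volume : Measure UnitAddCircle) →
        Ergodic shift (factorComponent P t)) ∧
      (NontrivialOnErgodicCircles P →
        ∀ t : UnitAddCircle, Ergodic (circleRotation t) (volume : Measure UnitAddCircle) →
          ¬ ∃ x : ℕ → K, factorComponent P t = Measure.dirac x)) := by
  refine ⟨measurePreserving_skewMap, ae_ergodic_circleRotation,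
    fun Y _ S ν _ hS => furstenbergDisjoint_skewMap hS,
    fun K _ hK => exists_nontrivialOnErgodicCircles hK, fun K hK P hP => ?_⟩
  refine ⟨isProbabilityMeasure_symbolicFactor hP, measurePreserving_shift_symbolicFactor hP,
    measurePreserving_itinerary hP, semiconj_itinerary P, ?_, ?_,
    fun E hE => symbolicFactor_apply hP hE, fun t ht => ergodic_factorComponent hP ht, ?_⟩
  · exact fun Y _ S ν _ hS => furstenbergDisjoint_symbolicFactor hS hP
  · exact fun L hL ν _ hν => FurstenbergDisjoint.uncorrelated hK hL
      (furstenbergDisjoint_symbolicFactor hν hP)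
  · rintro hn t ht ⟨x, hx⟩
    exact factorComponent_ne_dirac hP hn ht x hx
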